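/- For a continuous driver $\lambda\colon[0,T]\to\mathbb C$ and $z\in\mathbb C$, let $g_t(z)$ be the solution of the Loewner equation $\partial_t g_t(z)=\frac{2}{g_t(z)-\lambda(t)}$, $g_0(z)=z$, up to its blow-up time $T_z=\inf\{t\ge 0:\lim_{s\uparrow t}|g_s(z)-\lambda(s)|=0\}$ (with $T_{\lambda(0)}=0$). Let $L_t=L_t(\lambda)=\{z: T_z\le t\}$ be the left hull and $R_t=R_t(\lambda)=\mathbb C\setminus g_t(\mathbb C\setminus L_t)$ the right hull, and write $L_{t,t+s}=L_s(\lambda(t+\cdot))$. The sufficient condition for simplicity on $[0,T]$ is that $$L_{t,t+s}\cap R_t=\{\lambda(t)\}\qquad\text{for all } s,t\ge 0 \text{ with } t+s\le T.\tag{$*$}$$ We say that $\lambda$ creates the two-sided curve $\gamma\colon[-T,T]\to\mathbb C$ if $\gamma$ is continuous and $L_t=\gamma([-t,t])$ for all $t\in[0,T]$. The curve is simple if it revisits a point only by resting there: $a\le b$ and $\gamma(a)=\gamma(b)$ imply that $\gamma$ is constant on $[a,b]$. There is a driver $\lambda\in C^0([0,2];\mathbb C)$, $C^\infty$ at every point of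 $[0,2]$ except at exactly one point, that violates $(*)$ with $T=2$, and yet creates a simple two-sided curve $\gamma\colon[-2,2]\to\mathbb C$. One end of this curve stops growing after time $1$, while the whole curve remains simple up to time $2$: $\gamma$ is injective on $[-1,2]$ and constant on $[-2,-1]$. In particular, $(*)$ is not necessary for a continuous driver to create a simple two-sided curve. -/

import Mathlib

open Set Filter Topology
open scoped ContDiff

namespace ComplexLoewner

/-- `g` solves the Loewner equation `∂ₛ g = 2 / (g - lam)`, `g 0 = z`, on the time set `I`
(which is `[0, τ)` or `[0, t]` below); in particular `g` does not meet the driver on `I`. -/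
def IsLoewnerSolution (lam : ℝ → ℂ) (z : ℂ) (I : Set ℝ) (g : ℝ → ℂ) : Prop :=
  g 0 = z ∧ ∀ s ∈ I, g s ≠ lam s ∧ HasDerivWithinAt g (2 / (g s - lam s)) I s

/-- The solution started at `z` runs into the driver at time `τ`, that is,
`|g_s(z) - lam s| → 0` as `s ↑ τ`. At time `0` this happens exactly for `z = lam 0`. -/
def BlowsUpAt (lam : ℝ → ℂ) (z : ℂ) (τ : ℝ) : Prop :=
  (τ = 0 ∧ z = lam 0) ∨
    (0 < τ ∧ ∃ g : ℝ → ℂ, IsLoewnerSolution lam z (Ico 0 τ) g ∧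
      Tendsto (fun s => ‖g s - lam s‖) (𝓝[<] τ) (𝓝 0))

/-- The blow-up time `T_z`, equal to `⊤` if there is no blow-up. -/
noncomputable def blowUpTime (lam : ℝ → ℂ) (z : ℂ) : EReal :=
  sInf ((fun τ : ℝ => (τ : EReal)) '' {τ : ℝ | BlowsUpAt lam z τ})

/-- The left hull `L_t = {z | T_z ≤ t}`. -/
def leftHull (lam : ℝ → ℂ) (t : ℝ) : Set ℂ :=
  {z : ℂ | blowUpTime lam z ≤ (t : EReal)}

/-- The graph of the mapping-out function: `g_t(z) = w`. -/
def LoewnerMapsTo (lam : ℝ → ℂ) (t : ℝ) (z w : ℂ) : Prop :=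
  ∃ g : ℝ → ℂ, IsLoewnerSolution lam z (Icc 0 t) g ∧ g t = w

/-- The right hull `R_t = ℂ \ g_t(ℂ \ L_t)`. -/
def rightHull (lam : ℝ → ℂ) (t : ℝ) : Set ℂ :=
  {w : ℂ | ∃ z, z ∉ leftHull lam t ∧ LoewnerMapsTo lam t z w}ᶜ

/-- The hull `L_{t,t+s}`: the left hull at time `s` of the shifted driver `lam (t + ·)`. -/
def shiftedLeftHull (lam : ℝ → ℂ) (t s : ℝ) : Set ℂ :=
  leftHull (fun u => lam (t + u)) s

/-- The sufficient condition for simplicity on the time interval `[0, T]`: at every time `t`, the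
future hull `L_{t,t+s}` meets the right hull `R_t` only at the driving point `lam t`. -/
def HullsMeetOnlyAtDriver (lam : ℝ → ℂ) (T : ℝ) : Prop :=
  ∀ t s : ℝ, 0 ≤ t → 0 ≤ s → t + s ≤ T →
    shiftedLeftHull lam t s ∩ rightHull lam t = {lam t}

/-- On the time interval `[0, T]`, the driver creates the two-sided curve
`γ : [-T, T] → ℂ`: `γ` is continuous and `L_t = γ([-t, t])` for all `t ∈ [0, T]`. -/
def CreatesTwoSidedCurve (lam : ℝ → ℂ) (T : ℝ) (γ : ℝ → ℂ) : Prop :=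
  ContinuousOn γ (Icc (-T) T) ∧ ∀ t ∈ Icc 0 T, leftHull lam t = γ '' Icc (-t) t

/-- `γ : [-T, T] → ℂ` traces a simple curve: it revisits a point only by resting there. (An end
that has stopped growing is constant from then on.) -/
def IsSimpleTwoSidedCurve (T : ℝ) (γ : ℝ → ℂ) : Prop :=
  ∀ a ∈ Icc (-T) T, ∀ b ∈ Icc (-T) T, a ≤ b → γ a = γ b → ∀ u ∈ Icc a b, γ u = γ a

end ComplexLoewner

namespace ComplexLoewner

/-! ### Uniqueness of solutions and of blow-up times -/

/-! The driver is a multiple of `D = sqrtDriver`, a square root of `4 (t - 1)`: it descends the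
imaginary axis to `0` at time `1`, then leaves along the positive real axis. After rescaling, the
flow is `G' = (3/2) / (G - D)`. It preserves the quartic `invariant`, which factors as `(G - 3D/2)
(G + D/2) ^ 3`, and conversely continuous branches of its level sets are flow lines away from the
critical points (`IsFlowLine.invariant_eq`, `IsFlowLine.of_invariant`).

At a collision with the driver at time `τ` the quartic equals `-27 (τ - 1) ^ 2`, so the collision
times `1 - m` and `1 + m` share one level. For `0 < m < 1` the four initial points on that level can
be found explicitly (`initial_cases`): two on the imaginary axis, which collide at time `1 - m`; one
in the right half plane, which collides at time `1 + m`; one in the left half plane, which never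
collides because the driver has nonnegative real part. Hence the hull grows at two ends up to time
`1` and at a single end afterwards. Distinct collision times make the curve simple.

The condition fails at time `1`. From then on the driver is real, so the hull it generates is
symmetric under conjugation and has two branches. The upper branch has a point (`sideLine 1 1 1`)
that no unabsorbed initial point reaches at time `1`, so this point lies in the right hull although
it is not the driving point. -/

theorem IsLoewnerSolution.mono {lam : ℝ → ℂ} {z : ℂ} {I J : Set ℝ} {g : ℝ → ℂ}
    (h : IsLoewnerSolution lam z I g) (hJ : J ⊆ I) : IsLoewnerSolution lam z J g :=
  ⟨h.1, fun s hs => ⟨(h.2 s (hJ hs)).1, (h.2 s (hJ hs)).2.mono hJ⟩⟩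

theorem IsLoewnerSolution.continuousOn {lam : ℝ → ℂ} {z : ℂ} {I : Set ℝ} {g : ℝ → ℂ}
    (h : IsLoewnerSolution lam z I g) : ContinuousOn g I :=
  fun s hs => (h.2 s hs).2.continuousWithinAt

theorem IsLoewnerSolution.exists_lower_bound {lam : ℝ → ℂ} (hlam : Continuous lam) {z : ℂ} {T : ℝ}
    (hT : 0 ≤ T) {g : ℝ → ℂ} (h : IsLoewnerSolution lam z (Icc 0 T) g) :
    ∃ ε > 0, ∀ s ∈ Icc 0 T, ε ≤ ‖g s - lam s‖ := by
  obtain ⟨x, hx, hmin⟩ := isCompact_Icc.exists_isMinOn (nonempty_Icc.2 hT)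
    ((h.continuousOn.sub hlam.continuousOn).norm)
  exact ⟨‖g x - lam x‖, norm_pos_iff.2 (sub_ne_zero.2 (h.2 x hx).1), fun s hs => hmin hs⟩

/-- On a compact time interval both solutions keep a distance `η > 0` from the driver, and there the
vector field is Lipschitz with constant `2 / η ^ 2`. -/
theorem IsLoewnerSolution.eqOn {lam : ℝ → ℂ} (hlam : Continuous lam) {z : ℂ} {T : ℝ}
    {g k : ℝ → ℂ} (hg : IsLoewnerSolution lam z (Icc 0 T) g)
    (hk : IsLoewnerSolution lam z (Icc 0 T) k) : EqOn g k (Icc 0 T) := by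
  rcases lt_or_ge T 0 with hT | hT
  · simp [Icc_eq_empty (not_le.2 hT)]
  obtain ⟨ε, hε, hgε⟩ := hg.exists_lower_bound hlam hT
  obtain ⟨δ, hδ, hkδ⟩ := hk.exists_lower_bound hlam hT
  set η := min ε δ with hη
  have hη0 : 0 < η := lt_min hε hδ
  refine ODE_solution_unique_of_mem_Icc_right (v := fun t x => 2 / (x - lam t))
    (s := fun t => {x | η ≤ ‖x - lam t‖}) (K := (2 / η ^ 2).toNNReal) ?_ hg.continuousOn ?_ ?_
    hk.continuousOn ?_ ?_ (hg.1.trans hk.1.symm)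
  · intro t _
    refine LipschitzOnWith.of_dist_le_mul fun x hx y hy => ?_
    have hx0 : x - lam t ≠ 0 := norm_pos_iff.1 (hη0.trans_le hx)
    have hy0 : y - lam t ≠ 0 := norm_pos_iff.1 (hη0.trans_le hy)
    rw [Real.coe_toNNReal _ (by positivity), dist_eq_norm, dist_eq_norm]
    have : 2 / (x - lam t) - 2 / (y - lam t) = 2 * (y - x) / ((x - lam t) * (y - lam t)) := by
      field_simp
      ring
    rw [this, norm_div, norm_mul, norm_mul, norm_sub_rev y x, div_mul_eq_mul_div]
    simp only [RCLike.norm_ofNat]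
    have hxy : η ^ 2 ≤ ‖x - lam t‖ * ‖y - lam t‖ := by
      rw [sq]
      exact mul_le_mul hx hy hη0.le (norm_nonneg _)
    gcongr
  · intro t ht
    exact (hg.2 t ⟨ht.1, ht.2.le⟩).2.mono_of_mem_nhdsWithin
      (mem_of_superset (Icc_mem_nhdsGE ht.2) (Icc_subset_Icc_left ht.1))
  · intro t ht
    exact (min_le_left _ _).trans (hgε t ⟨ht.1, ht.2.le⟩)
  · intro t ht
    exact (hk.2 t ⟨ht.1, ht.2.le⟩).2.mono_of_mem_nhdsWithin
      (mem_of_superset (Icc_mem_nhdsGE ht.2) (Icc_subset_Icc_left ht.1))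
  · intro t ht
    exact (min_le_right _ _).trans (hkδ t ⟨ht.1, ht.2.le⟩)

theorem BlowsUpAt.nonneg {lam : ℝ → ℂ} {z : ℂ} {τ : ℝ} (h : BlowsUpAt lam z τ) : 0 ≤ τ := by
  rcases h with ⟨h, -⟩ | ⟨h, -⟩
  exacts [h.ge, h.le]

/-- A solution alive beyond `τ` agrees with the one that collides at `τ`, yet by continuity has
nonzero distance from the driver there. -/
theorem BlowsUpAt.not_lt {lam : ℝ → ℂ} (hlam : Continuous lam) {z : ℂ} {τ σ : ℝ}
    (hτ : BlowsUpAt lam z τ) (hσ : BlowsUpAt lam z σ) : ¬ τ < σ := by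
  intro hlt
  rcases hσ with ⟨rfl, -⟩ | ⟨hσ0, k, hk, -⟩
  · exact absurd hτ.nonneg (not_le.2 hlt)
  rcases hτ with ⟨rfl, rfl⟩ | ⟨hτ0, g, hg, hlim⟩
  · exact (hk.2 0 ⟨le_rfl, hσ0⟩).1 hk.1
  · have hk' : IsLoewnerSolution lam z (Icc 0 τ) k :=
      hk.mono fun s hs => ⟨hs.1, hs.2.trans_lt hlt⟩
    have hev : (fun s => ‖g s - lam s‖) =ᶠ[𝓝[<] τ] fun s => ‖k s - lam s‖ := by
      filter_upwards [Ioo_mem_nhdsLT hτ0] with s hs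
      have := IsLoewnerSolution.eqOn hlam
        (hg.mono fun r (hr : r ∈ Icc 0 s) => ⟨hr.1, hr.2.trans_lt hs.2⟩)
        (hk'.mono (Icc_subset_Icc_right hs.2.le)) ⟨hs.1.le, le_rfl⟩
      rw [this]
    have hc : Tendsto (fun s => ‖k s - lam s‖) (𝓝[<] τ) (𝓝 ‖k τ - lam τ‖) := by
      have h1 : ContinuousWithinAt (fun s => ‖k s - lam s‖) (Icc 0 τ) τ :=
        ((hk'.continuousOn.sub hlam.continuousOn).norm) τ ⟨hτ0.le, le_rfl⟩
      exact h1.tendsto.mono_left (nhdsWithin_le_of_mem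
        (mem_of_superset (Ioo_mem_nhdsLT hτ0) Ioo_subset_Icc_self))
    have h0 := tendsto_nhds_unique (hlim.congr' hev) hc
    exact (hk'.2 τ ⟨hτ0.le, le_rfl⟩).1 (sub_eq_zero.1 (norm_eq_zero.1 h0.symm))

theorem BlowsUpAt.unique {lam : ℝ → ℂ} (hlam : Continuous lam) {z : ℂ} {τ σ : ℝ}
    (hτ : BlowsUpAt lam z τ) (hσ : BlowsUpAt lam z σ) : τ = σ :=
  le_antisymm (le_of_not_gt (hσ.not_lt hlam hτ)) (le_of_not_gt (hτ.not_lt hlam hσ))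

theorem BlowsUpAt.mem_leftHull {lam : ℝ → ℂ} {z : ℂ} {τ t : ℝ} (hτ : BlowsUpAt lam z τ)
    (h : τ ≤ t) : z ∈ leftHull lam t :=
  (sInf_le ⟨τ, hτ, rfl⟩ : blowUpTime lam z ≤ (τ : EReal)).trans (EReal.coe_le_coe_iff.2 h)

/-- There is at most one blow-up time, so the infimum defining `blowUpTime` is attained unless it is
`⊤`. -/
theorem exists_blowsUpAt_of_mem_leftHull {lam : ℝ → ℂ} (hlam : Continuous lam) {z : ℂ} {t : ℝ}
    (h : z ∈ leftHull lam t) : ∃ τ ≤ t, BlowsUpAt lam z τ := by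
  by_cases hne : ∃ τ, BlowsUpAt lam z τ
  · obtain ⟨τ, hτ⟩ := hne
    refine ⟨τ, EReal.coe_le_coe_iff.1 (le_trans (le_sInf ?_) h), hτ⟩
    rintro _ ⟨σ, hσ, rfl⟩
    exact EReal.coe_le_coe_iff.2 (hτ.unique hlam hσ).le
  · have : {τ : ℝ | BlowsUpAt lam z τ} = ∅ := eq_empty_of_forall_notMem fun τ hτ => hne ⟨τ, hτ⟩
    simp [leftHull, blowUpTime, this] at h

/-! ### The largest root of a cubic -/

theorem exists_cubic_root (m x : ℝ) :
    ∃ d : ℝ, 0 ≤ d ∧ d ^ 3 = 108 * m ^ 2 * (d + 4 * |x|) ∧ (m ≠ 0 → 0 < d) := by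
  rcases eq_or_ne m 0 with rfl | hm
  · exact ⟨0, le_rfl, by simp, by simp⟩
  set K := 108 * m ^ 2 with hK
  have hK0 : 0 < K := by positivity
  have hx := abs_nonneg x
  set y := |x|
  have hs : √K ^ 2 = K := Real.sq_sqrt hK0.le
  have hs0 : 0 < √K := Real.sqrt_pos.2 hK0
  have hle : √K ≤ 1 + K + 4 * y := by nlinarith [sq_nonneg (√K - 1)]
  -- Starting the intermediate value argument at `√K` rather than `0` keeps the root positive.
  have hcont : ContinuousOn (fun d : ℝ => d ^ 3 - K * (d + 4 * y)) (Icc (√K) (1 + K + 4 * y)) := by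
    fun_prop
  have h1 : √K ^ 3 - K * (√K + 4 * y) ≤ 0 := by
    have : √K ^ 3 = K * √K := by rw [pow_succ, hs]
    nlinarith [mul_nonneg hK0.le hx]
  have h2 : 0 ≤ (1 + K + 4 * y) ^ 3 - K * (1 + K + 4 * y + 4 * y) := by
    have : 0 ≤ K * y := by positivity
    have : 0 ≤ K ^ 2 * y := by positivity
    have : 0 ≤ K * y ^ 2 := by positivity
    have : 0 ≤ K ^ 2 := by positivity
    have : 0 ≤ K ^ 3 := by positivity
    have : 0 ≤ y ^ 2 := by positivity
    have : 0 ≤ y ^ 3 := by positivity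
    nlinarith
  obtain ⟨d, hd, hd0⟩ := intermediate_value_Icc hle hcont ⟨h1, h2⟩
  exact ⟨d, hs0.le.trans hd.1, sub_eq_zero.1 hd0, fun _ => hs0.trans_le hd.1⟩

/-- The nonnegative root `d` of `d ^ 3 = 108 * m ^ 2 * (d + 4 * |x|)`, positive unless `m = 0`. -/
noncomputable def cubicRoot (m x : ℝ) : ℝ := (exists_cubic_root m x).choose

theorem cubicRoot_nonneg (m x : ℝ) : 0 ≤ cubicRoot m x := (exists_cubic_root m x).choose_spec.1

theorem cubicRoot_pow (m x : ℝ) :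
    cubicRoot m x ^ 3 = 108 * m ^ 2 * (cubicRoot m x + 4 * |x|) :=
  (exists_cubic_root m x).choose_spec.2.1

theorem cubicRoot_pos {m : ℝ} (hm : m ≠ 0) (x : ℝ) : 0 < cubicRoot m x :=
  (exists_cubic_root m x).choose_spec.2.2 hm

theorem cubicRoot_zero_left (x : ℝ) : cubicRoot 0 x = 0 := by
  have := cubicRoot_pow 0 x
  simpa using this

/-- The ratio `a ^ 3 / (a + 4 * |x|)` is strictly increasing for `a > 0`, so the root is located by
testing the cubic. Together with `le_cubicRoot` this gives uniqueness, bounds and continuity of the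
chosen root. -/
theorem cubicRoot_le {m x a : ℝ} (ha : 0 < a) (h : 108 * m ^ 2 * (a + 4 * |x|) ≤ a ^ 3) :
    cubicRoot m x ≤ a := by
  by_contra! hlt
  have hd := cubicRoot_pow m x
  set d := cubicRoot m x
  have hx := abs_nonneg x
  set y := |x|
  have h1 : d ^ 3 * (a + 4 * y) ≤ a ^ 3 * (d + 4 * y) := by
    rw [hd]
    nlinarith [mul_le_mul_of_nonneg_right h (by linarith : 0 ≤ d + 4 * y)]
  have h3 : a ^ 3 ≤ d ^ 3 := pow_le_pow_left₀ ha.le hlt.le 3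
  have h2 : a ^ 2 < d ^ 2 := pow_lt_pow_left₀ hlt ha.le two_ne_zero
  nlinarith [mul_pos (mul_pos ha (ha.trans hlt)) (sub_pos.2 h2),
    mul_nonneg (sub_nonneg.2 h3) hx]

theorem le_cubicRoot {m x a : ℝ} (hm : m ≠ 0) (h : a ^ 3 ≤ 108 * m ^ 2 * (a + 4 * |x|)) :
    a ≤ cubicRoot m x := by
  by_contra! hlt
  have hd := cubicRoot_pow m x
  have hd0 := cubicRoot_pos hm x
  set d := cubicRoot m x
  have hx := abs_nonneg x
  set y := |x|
  have h1 : a ^ 3 * (d + 4 * y) ≤ d ^ 3 * (a + 4 * y) := by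
    rw [hd]
    nlinarith [mul_le_mul_of_nonneg_right h (by linarith : 0 ≤ d + 4 * y)]
  have h3 : d ^ 3 ≤ a ^ 3 := pow_le_pow_left₀ hd0.le hlt.le 3
  have h2 : d ^ 2 < a ^ 2 := pow_lt_pow_left₀ hlt hd0.le two_ne_zero
  nlinarith [mul_pos (mul_pos hd0 (hd0.trans hlt)) (sub_pos.2 h2),
    mul_nonneg (sub_nonneg.2 h3) hx]

/-- Joint continuity is needed: flow lines fix `m` and vary the time, while the curve fixes time `0`
and varies `m`. -/
theorem continuous_cubicRoot : Continuous fun p : ℝ × ℝ => cubicRoot p.1 p.2 := by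
  rw [continuous_iff_continuousAt]
  rintro ⟨m, x⟩
  have hL (a : ℝ) : Continuous fun p : ℝ × ℝ => 108 * p.1 ^ 2 * (a + 4 * |p.2|) := by fun_prop
  refine tendsto_order.2 ⟨fun a ha => ?_, fun a ha => ?_⟩
  · rcases eq_or_ne m 0 with rfl | hm
    · simp only [cubicRoot_zero_left] at ha
      exact Eventually.of_forall fun p => ha.trans_le (cubicRoot_nonneg _ _)
    · obtain ⟨c, hc, hcd⟩ := exists_between (max_lt ha (cubicRoot_pos hm x))
      have hc0 : 0 < c := (le_max_right _ _).trans_lt hc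
      have hlt : c ^ 3 < 108 * m ^ 2 * (c + 4 * |x|) := by
        by_contra! hle
        exact absurd (cubicRoot_le hc0 hle) (not_le.2 hcd)
      filter_upwards [(hL c).continuousAt.eventually (lt_mem_nhds hlt),
        (continuous_fst (X := ℝ) (Y := ℝ)).continuousAt.eventually_ne (x := (m, x)) hm] with p hp hp0
      exact ((le_max_left _ _).trans_lt hc).trans_le (le_cubicRoot hp0 hp.le)
  · obtain ⟨c, hc, hca⟩ := exists_between ha
    have hc0 : 0 < c := (cubicRoot_nonneg _ _).trans_lt hc
    have hlt : 108 * m ^ 2 * (c + 4 * |x|) < c ^ 3 := by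
      rcases eq_or_ne m 0 with rfl | hm
      · simpa using pow_pos hc0 3
      · by_contra! hle
        exact absurd (le_cubicRoot hm hle) (not_le.2 hc)
    filter_upwards [(hL c).continuousAt.eventually (gt_mem_nhds hlt)] with p hp
    exact (cubicRoot_le hc0 hp.le).trans_lt hca

/-- The sum of a pair of roots of the quartic that is preserved by the flow. -/
noncomputable def rootSum (m x : ℝ) : ℝ := √(cubicRoot m x + 4 * |x|)

theorem rootSum_sq (m x : ℝ) : rootSum m x ^ 2 = cubicRoot m x + 4 * |x| :=
  Real.sq_sqrt (by have := cubicRoot_nonneg m x; positivity)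

theorem rootSum_cubic (m x : ℝ) :
    (rootSum m x ^ 2 - 4 * |x|) ^ 3 = 108 * m ^ 2 * rootSum m x ^ 2 := by
  rw [rootSum_sq, ← cubicRoot_pow]
  ring

theorem rootSum_pos {m x : ℝ} (h : m ≠ 0 ∨ x ≠ 0) : 0 < rootSum m x := by
  refine Real.sqrt_pos.2 ?_
  rcases h with h | h
  · have := cubicRoot_pos h x
    positivity
  · have := cubicRoot_nonneg m x
    positivity

theorem two_mul_sqrt_le_rootSum (m x : ℝ) : 2 * √|x| ≤ rootSum m x := by
  refine Real.le_sqrt_of_sq_le ?_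
  rw [mul_pow, Real.sq_sqrt (abs_nonneg x)]
  linarith [cubicRoot_nonneg m x]

theorem two_mul_sqrt_lt_rootSum {m : ℝ} (hm : m ≠ 0) (x : ℝ) : 2 * √|x| < rootSum m x := by
  refine Real.lt_sqrt_of_sq_lt ?_
  rw [mul_pow, Real.sq_sqrt (abs_nonneg x)]
  linarith [cubicRoot_pos hm x]

theorem rootSum_le {m x : ℝ} (hx : x ≠ 0) (h : |m| ≤ |x|) : rootSum m x ≤ 4 * √|x| := by
  have hx0 : 0 < |x| := abs_pos.2 hx
  have hm : m ^ 2 ≤ |x| ^ 2 := by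
    rw [← sq_abs m]
    exact pow_le_pow_left₀ (abs_nonneg _) h 2
  -- At `12 * |x|` the cubic inequality reads `m ^ 2 ≤ x ^ 2`, and `12 * |x| + 4 * |x|` is the
  -- square of `4 * √|x|`. This threshold marks the collision times `1 ± m`.
  have := cubicRoot_le (m := m) (x := x) (a := 12 * |x|) (by positivity) (by
    nlinarith [mul_le_mul_of_nonneg_right hm hx0.le])
  refine Real.sqrt_le_iff.2 ⟨by positivity, ?_⟩
  rw [mul_pow, Real.sq_sqrt (abs_nonneg x)]
  linarith

theorem le_rootSum {m x : ℝ} (hm : m ≠ 0) (h : |x| ≤ |m|) : 4 * √|x| ≤ rootSum m x := by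
  have hm' : |x| ^ 2 ≤ m ^ 2 := by
    rw [← sq_abs m]
    exact pow_le_pow_left₀ (abs_nonneg _) h 2
  have := le_cubicRoot (m := m) (x := x) (a := 12 * |x|) hm (by
    nlinarith [mul_le_mul_of_nonneg_right hm' (abs_nonneg x)])
  refine Real.le_sqrt_of_sq_le ?_
  rw [mul_pow, Real.sq_sqrt (abs_nonneg x)]
  linarith

theorem rootSum_eq {m x : ℝ} (hx : x ≠ 0) (h : |m| = |x|) : rootSum m x = 4 * √|x| :=
  le_antisymm (rootSum_le hx h.le) (le_rootSum (abs_pos.1 (h ▸ abs_pos.2 hx)) h.ge)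

theorem rootSum_zero_left (x : ℝ) : rootSum 0 x = 2 * √|x| := by
  rw [rootSum, cubicRoot_zero_left, zero_add, show (4 : ℝ) * |x| = 2 ^ 2 * |x| by ring,
    Real.sqrt_mul (by positivity), Real.sqrt_sq (by positivity)]

theorem continuous_rootSum : Continuous fun p : ℝ × ℝ => rootSum p.1 p.2 :=
  (continuous_cubicRoot.add (by fun_prop)).sqrt


/-! ### The driver and its conserved quantity -/

/-- The normalized driver, with `sqrtDriver t ^ 2 = 4 * (t - 1)`. -/
noncomputable def sqrtDriver (t : ℝ) : ℂ := 2 * ((√(t - 1) : ℝ) + (√(1 - t) : ℝ) * Complex.I)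

theorem sqrtDriver_of_le {t : ℝ} (ht : t ≤ 1) :
    sqrtDriver t = 2 * ((√(1 - t) : ℝ) * Complex.I) := by
  simp [sqrtDriver, Real.sqrt_eq_zero_of_nonpos (sub_nonpos.2 ht)]

theorem sqrtDriver_of_ge {t : ℝ} (ht : 1 ≤ t) : sqrtDriver t = 2 * (√(t - 1) : ℝ) := by
  simp [sqrtDriver, Real.sqrt_eq_zero_of_nonpos (sub_nonpos.2 ht)]

theorem continuous_sqrtDriver : Continuous sqrtDriver := by
  unfold sqrtDriver
  fun_prop

theorem ofReal_sqrt_sq {x : ℝ} (hx : 0 ≤ x) : ((√x : ℝ) : ℂ) ^ 2 = x := by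
  rw [← Complex.ofReal_pow, Real.sq_sqrt hx]

theorem sqrtDriver_sq (t : ℝ) : sqrtDriver t ^ 2 = 4 * ((t : ℂ) - 1) := by
  rcases le_total t 1 with ht | ht
  · rw [sqrtDriver_of_le ht, mul_pow, mul_pow, ofReal_sqrt_sq (sub_nonneg.2 ht), Complex.I_sq]
    push_cast
    ring
  · rw [sqrtDriver_of_ge ht, mul_pow, ofReal_sqrt_sq (sub_nonneg.2 ht)]
    push_cast
    ring

theorem sqrtDriver_one : sqrtDriver 1 = 0 := by simp [sqrtDriver]

theorem sqrtDriver_ne_zero {t : ℝ} (ht : t ≠ 1) : sqrtDriver t ≠ 0 := by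
  intro h
  have h1 := sqrtDriver_sq t
  rw [h] at h1
  have h2 : ((t : ℂ) - 1) = 0 := by linear_combination -h1 / 4
  exact ht (by exact_mod_cast sub_eq_zero.1 h2)

theorem sqrtDriver_re_nonneg (t : ℝ) : 0 ≤ (sqrtDriver t).re := by
  simp [sqrtDriver]

theorem sqrtDriver_re_of_le {t : ℝ} (ht : t ≤ 1) : (sqrtDriver t).re = 0 := by
  simp [sqrtDriver_of_le ht]

theorem contDiffAt_sqrtDriver {t : ℝ} (ht : t ≠ 1) : ContDiffAt ℝ ∞ sqrtDriver t := by
  have h1 : ContDiffAt ℝ ∞ (fun t : ℝ => √(t - 1)) t :=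
    (contDiffAt_id.sub contDiffAt_const).sqrt (sub_ne_zero.2 ht)
  have h2 : ContDiffAt ℝ ∞ (fun t : ℝ => √(1 - t)) t :=
    (contDiffAt_const.sub contDiffAt_id).sqrt (sub_ne_zero.2 ht.symm)
  exact contDiffAt_const.mul ((Complex.ofRealCLM.contDiff.contDiffAt.comp t h1).add
    ((Complex.ofRealCLM.contDiff.contDiffAt.comp t h2).mul contDiffAt_const))

theorem hasDerivAt_sub_one (t : ℝ) : HasDerivAt (fun s : ℝ => (s : ℂ) - 1) 1 t :=
  Complex.ofRealCLM.hasDerivAt.sub_const 1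

theorem hasDerivAt_sqrtDriver {t : ℝ} (ht : t ≠ 1) :
    HasDerivAt sqrtDriver (2 / sqrtDriver t) t := by
  have hd := ((contDiffAt_sqrtDriver ht).differentiableAt (by simp)).hasDerivAt
  have h1 := hd.pow 2
  have h2 : HasDerivAt (sqrtDriver ^ 2) (4 * 1) t := by
    have : sqrtDriver ^ 2 = fun s : ℝ => 4 * ((s : ℂ) - 1) := funext sqrtDriver_sq
    rw [this]
    exact (hasDerivAt_sub_one t).const_mul 4
  have h3 := h1.unique h2
  have h0 := sqrtDriver_ne_zero ht
  refine hd.congr_deriv ((eq_div_iff h0).2 ?_)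
  norm_num at h3
  linear_combination h3 / 2

/-- The factor `t - 1` removes the singularity of the driver at time `1`, so the invariant is
differentiable in time even there. -/
theorem hasDerivAt_sub_one_mul_sqrtDriver (t : ℝ) :
    HasDerivAt (fun s : ℝ => ((s : ℂ) - 1) * sqrtDriver s) (3 / 2 * sqrtDriver t) t := by
  rcases eq_or_ne t 1 with rfl | ht
  · rw [sqrtDriver_one, mul_zero, hasDerivAt_iff_tendsto_slope]
    have hc : Tendsto sqrtDriver (𝓝[≠] 1) (𝓝 0) := by
      have := continuous_sqrtDriver.tendsto 1
      rw [sqrtDriver_one] at this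
      exact this.mono_left nhdsWithin_le_nhds
    refine hc.congr' ?_
    filter_upwards [self_mem_nhdsWithin] with s (hs : s ≠ 1)
    have hs' : (s : ℂ) - 1 ≠ 0 := sub_ne_zero.2 (by exact_mod_cast hs)
    simp only [slope_def_module, sqrtDriver_one, Complex.real_smul]
    push_cast
    field_simp
    simp
  · refine ((hasDerivAt_sub_one t).mul (hasDerivAt_sqrtDriver ht)).congr_deriv ?_
    have h0 := sqrtDriver_ne_zero ht
    field_simp
    linear_combination -sqrtDriver_sq t

/-- The quantity that is preserved by the flow `∂ₜ G = (3 / 2) / (G - sqrtDriver)`. -/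
noncomputable def invariant (G : ℂ) (t : ℝ) : ℂ :=
  G ^ 4 - 6 * ((t : ℂ) - 1) * G ^ 2 - 4 * (((t : ℂ) - 1) * sqrtDriver t) * G - 3 * ((t : ℂ) - 1) ^ 2

theorem invariant_sqrtDriver (t : ℝ) :
    invariant (sqrtDriver t) t = -27 * ((t : ℂ) - 1) ^ 2 := by
  have := sqrtDriver_sq t
  unfold invariant
  linear_combination (sqrtDriver t ^ 2 - 6 * ((t : ℂ) - 1)) * this

theorem invariant_eq_zero {G : ℂ} {t : ℝ} (h : 2 * G + sqrtDriver t = 0) : invariant G t = 0 := by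
  have h1 : sqrtDriver t = -2 * G := by linear_combination h
  have h2 := sqrtDriver_sq t
  rw [h1] at h2
  have h3 : ((t : ℂ) - 1) = G ^ 2 := by linear_combination -h2 / 4
  rw [invariant, h1, h3]
  ring

theorem continuous_invariant : Continuous fun p : ℂ × ℝ => invariant p.1 p.2 := by
  have := continuous_sqrtDriver
  unfold invariant
  fun_prop

theorem hasDerivAt_invariant_right (G : ℂ) (t : ℝ) :
    HasDerivAt (invariant G) (-(3 / 2) * (2 * G + sqrtDriver t) ^ 2) t := by
  have h := (((hasDerivAt_const t (G ^ 4)).sub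
    (((hasDerivAt_sub_one t).const_mul 6).mul_const (G ^ 2))).sub
    (((hasDerivAt_sub_one_mul_sqrtDriver t).const_mul 4).mul_const G)).sub
    (((hasDerivAt_sub_one t).pow 2).const_mul 3)
  refine h.congr_deriv ?_
  norm_num
  linear_combination (3 / 2) * sqrtDriver_sq t

/-- `G` solves the normalized equation, with driver `sqrtDriver`, on the time set `S`. -/
def IsFlowLine (G : ℝ → ℂ) (S : Set ℝ) : Prop :=
  ∀ t ∈ S, G t ≠ sqrtDriver t ∧ HasDerivWithinAt G (3 / 2 / (G t - sqrtDriver t)) S t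

theorem IsFlowLine.mono {G : ℝ → ℂ} {S S' : Set ℝ} (h : IsFlowLine G S) (hS : S' ⊆ S) :
    IsFlowLine G S' :=
  fun t ht => ⟨(h t (hS ht)).1, (h t (hS ht)).2.mono hS⟩

theorem IsFlowLine.continuousOn {G : ℝ → ℂ} {S : Set ℝ} (h : IsFlowLine G S) : ContinuousOn G S :=
  fun t ht => (h t ht).2.continuousWithinAt

theorem IsFlowLine.hasDerivWithinAt_Ici {G : ℝ → ℂ} {T t : ℝ} (h : IsFlowLine G (Icc 0 T))
    (ht : t ∈ Ico 0 T) : HasDerivWithinAt G (3 / 2 / (G t - sqrtDriver t)) (Ici t) t :=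
  (h t ⟨ht.1, ht.2.le⟩).2.mono_of_mem_nhdsWithin
    (mem_of_superset (Icc_mem_nhdsGE ht.2) (Icc_subset_Icc_left ht.1))

theorem IsFlowLine.invariant_eq {G : ℝ → ℂ} {T : ℝ} (h : IsFlowLine G (Icc 0 T)) {t : ℝ}
    (ht : t ∈ Icc 0 T) : invariant (G t) t = invariant (G 0) 0 := by
  have hc : ContinuousOn (fun s => invariant (G s) s) (Icc 0 T) :=
    continuous_invariant.comp_continuousOn (f := fun s => (G s, s))
      (h.continuousOn.prodMk (continuousOn_id' _))
  suffices hd : ∀ s ∈ Ico 0 T, HasDerivWithinAt (fun s => invariant (G s) s) 0 (Ici s) s from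
    constant_of_has_deriv_right_zero hc hd t ht
  intro s hs
  have hG := h.hasDerivWithinAt_Ici hs
  have hu := (hasDerivAt_sub_one s).hasDerivWithinAt (s := Ici s)
  have hq := (hasDerivAt_sub_one_mul_sqrtDriver s).hasDerivWithinAt (s := Ici s)
  have key := (((hG.pow 4).sub ((hu.const_mul 6).mul (hG.pow 2))).sub
    ((hq.const_mul 4).mul hG)).sub ((hu.pow 2).const_mul 3)
  refine key.congr_deriv ?_
  have h0 := sub_ne_zero.2 (h s ⟨hs.1, hs.2.le⟩).1
  simp only [Pi.pow_apply]
  norm_num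
  field_simp
  linear_combination 12 * G s * sqrtDriver_sq s

/-- Implicit differentiation: the partial derivatives of the invariant are `(G - D) (2G + D) ^ 2` in
`G` and `-(3/2) (2G + D) ^ 2` in time, with `D = sqrtDriver`, and their quotient gives the flow
equation. Only continuity of the branch is assumed, so explicit roots need not be differentiated. -/
theorem IsFlowLine.of_invariant {G : ℝ → ℂ} {S : Set ℝ} {C : ℂ} (hG : ContinuousOn G S)
    (hC : ∀ t ∈ S, invariant (G t) t = C) (h1 : ∀ t ∈ S, G t ≠ sqrtDriver t)
    (h2 : ∀ t ∈ S, 2 * G t + sqrtDriver t ≠ 0) : IsFlowLine G S := by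
  intro t ht
  refine ⟨h1 t ht, ?_⟩
  have hb := sub_ne_zero.2 (h1 t ht)
  have hb2 := h2 t ht
  set b := G t with hbdef
  have hGt : Tendsto G (𝓝[S \ {t}] t) (𝓝 b) := (hG t ht).tendsto.mono_left
    (nhdsWithin_mono _ sdiff_subset)
  have hid : Tendsto (fun s : ℝ => s) (𝓝[S \ {t}] t) (𝓝 t) :=
    tendsto_id.mono_left nhdsWithin_le_nhds
  -- `Q` is the divided difference of the invariant in its first variable, based at `b`; its value
  -- at `(b, t)` is the partial derivative.
  set Q : ℂ × ℝ → ℂ := fun p => p.1 ^ 3 + p.1 ^ 2 * b + p.1 * b ^ 2 + b ^ 3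
    - 6 * ((p.2 : ℂ) - 1) * (p.1 + b) - 4 * (((p.2 : ℂ) - 1) * sqrtDriver p.2) with hQ
  have hQc : Continuous Q := by
    have := continuous_sqrtDriver
    fun_prop
  have hQt : Tendsto (fun s => Q (G s, s)) (𝓝[S \ {t}] t) (𝓝 (Q (b, t))) :=
    (hQc.tendsto (b, t)).comp (hGt.prodMk_nhds hid)
  have hQb : Q (b, t) = (b - sqrtDriver t) * (2 * b + sqrtDriver t) ^ 2 := by
    simp only [hQ]
    linear_combination (sqrtDriver t + 3 * b) * sqrtDriver_sq t
  have hQ0 : Q (b, t) ≠ 0 := by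
    rw [hQb]
    exact mul_ne_zero hb (pow_ne_zero 2 hb2)
  have hs : Tendsto (slope (invariant b) t) (𝓝[S \ {t}] t)
      (𝓝 (-(3 / 2) * (2 * b + sqrtDriver t) ^ 2)) :=
    (hasDerivAt_iff_tendsto_slope.1 (hasDerivAt_invariant_right b t)).mono_left
      (nhdsWithin_mono _ fun s hs => hs.2)
  rw [hasDerivWithinAt_iff_tendsto_slope]
  have hlim := hs.neg.div hQt hQ0
  have hval : -(-(3 / 2) * (2 * b + sqrtDriver t) ^ 2) / Q (b, t) =
      3 / 2 / (b - sqrtDriver t) := by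
    rw [hQb]
    field_simp
  rw [hval] at hlim
  refine hlim.congr' ?_
  filter_upwards [hQt.eventually_ne hQ0, self_mem_nhdsWithin] with s hsQ hsS
  simp only [slope_def_module, Complex.real_smul, Pi.div_apply]
  rw [div_eq_iff hsQ]
  have e1 := hC s hsS.1
  have e2 := hC t ht
  have e3 : (G s - b) * Q (G s, s) = invariant b t - invariant b s := by
    rw [hbdef, e2, ← e1]
    simp only [hQ, invariant]
    ring
  rw [mul_assoc, e3]
  ring

/-! ### Flow lines cannot cross the imaginary axis -/

/-- The line where the real part is half its initial value is a barrier: there `G - sqrtDriver` has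
negative real part, hence so does the velocity. In `IsFlowLine.le_re` the mirrored argument needs
the driver on the imaginary axis, hence `T ≤ 1`. -/
theorem IsFlowLine.re_le {G : ℝ → ℂ} {T : ℝ} (h : IsFlowLine G (Icc 0 T)) (h0 : (G 0).re < 0)
    {t : ℝ} (ht : t ∈ Icc 0 T) : (G t).re ≤ (G 0).re / 2 := by
  refine image_le_of_deriv_right_lt_deriv_boundary (f := fun s => (G s).re)
    (f' := fun s => (3 / 2 / (G s - sqrtDriver s)).re) (B := fun _ => (G 0).re / 2)
    (B' := fun _ => 0) (Complex.continuous_re.comp_continuousOn h.continuousOn) ?_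
    (by linarith) (fun _ => hasDerivAt_const _ _) ?_ ht
  · intro s hs
    exact (Complex.reCLM.hasFDerivAt.comp_hasDerivWithinAt s (h.hasDerivWithinAt_Ici hs))
  · intro s hs hsB
    have hne := sub_ne_zero.2 (h s ⟨hs.1, hs.2.le⟩).1
    have hre := sqrtDriver_re_nonneg s
    have hn := Complex.normSq_pos.2 hne
    rw [Complex.div_re]
    norm_num
    exact div_neg_of_neg_of_pos (by linarith) hn

theorem IsFlowLine.le_re {G : ℝ → ℂ} {T : ℝ} (h : IsFlowLine G (Icc 0 T)) (hT : T ≤ 1)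
    (h0 : 0 < (G 0).re) {t : ℝ} (ht : t ∈ Icc 0 T) : (G 0).re / 2 ≤ (G t).re := by
  refine neg_le_neg_iff.1 (image_le_of_deriv_right_lt_deriv_boundary (f := fun s => -(G s).re)
    (f' := fun s => -(3 / 2 / (G s - sqrtDriver s)).re) (B := fun _ => -((G 0).re / 2))
    (B' := fun _ => 0) (Complex.continuous_re.comp_continuousOn h.continuousOn).neg ?_
    (by linarith) (fun _ => hasDerivAt_const _ _) ?_ ht)
  · intro s hs
    exact (Complex.reCLM.hasFDerivAt.comp_hasDerivWithinAt s (h.hasDerivWithinAt_Ici hs)).neg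
  · intro s hs hsB
    have hne := sub_ne_zero.2 (h s ⟨hs.1, hs.2.le⟩).1
    have hre := sqrtDriver_re_of_le (hs.2.le.trans hT)
    have hn := Complex.normSq_pos.2 hne
    rw [Complex.div_re]
    norm_num
    exact div_pos (by linarith) hn

/-! ### Rescaling to the Loewner equation -/

/-- The factor that turns the normalized equation into the Loewner equation. -/
noncomputable def scale : ℂ := (2 / √3 : ℝ)

theorem scale_sq : scale ^ 2 = 4 / 3 := by
  rw [scale, ← Complex.ofReal_pow, div_pow, Real.sq_sqrt (by norm_num)]
  norm_num

theorem scale_ne_zero : scale ≠ 0 := by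
  intro h
  have := scale_sq
  rw [h] at this
  norm_num at this

/-- The driver of the Loewner equation. -/
noncomputable def driver (t : ℝ) : ℂ := scale * sqrtDriver t

theorem continuous_driver : Continuous driver := continuous_const.mul continuous_sqrtDriver

theorem two_div_scale_mul (w : ℂ) : 2 / (scale * w) = scale * (3 / 2 / w) := by
  rcases eq_or_ne w 0 with rfl | hw
  · simp
  have := scale_ne_zero
  field_simp
  linear_combination -3 * scale_sq

theorem IsLoewnerSolution.isFlowLine {z : ℂ} {I : Set ℝ} {g : ℝ → ℂ}
    (h : IsLoewnerSolution driver z I g) : IsFlowLine (fun t => scale⁻¹ * g t) I := by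
  intro t ht
  have hg := h.2 t ht
  have h0 := scale_ne_zero
  have e : g t - driver t = scale * (scale⁻¹ * g t - sqrtDriver t) := by
    rw [driver, mul_sub, mul_inv_cancel_left₀ h0]
  refine ⟨fun heq => hg.1 ?_, ?_⟩
  · rw [← sub_eq_zero, e, show scale⁻¹ * g t = sqrtDriver t from heq, sub_self, mul_zero]
  · have := hg.2.const_mul scale⁻¹
    rwa [e, two_div_scale_mul, inv_mul_cancel_left₀ h0] at this

theorem IsFlowLine.isLoewnerSolution {G : ℝ → ℂ} {S I : Set ℝ} (h : IsFlowLine G S) (a : ℝ)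
    (hI : ∀ s ∈ I, a + s ∈ S) :
    IsLoewnerSolution (fun s => driver (a + s)) (scale * G a) I (fun s => scale * G (a + s)) := by
  refine ⟨by simp, fun s hs => ?_⟩
  have hG := h _ (hI s hs)
  have e : scale * G (a + s) - driver (a + s) = scale * (G (a + s) - sqrtDriver (a + s)) := by
    rw [driver, mul_sub]
  simp only [e, two_div_scale_mul]
  refine ⟨fun heq => hG.1 (mul_left_cancel₀ scale_ne_zero heq), ?_⟩
  have h1 : HasDerivWithinAt (fun s => a + s) 1 I s := (hasDerivWithinAt_id s I).const_add a
  have h2 := (hG.2.scomp s h1 hI).const_mul scale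
  simpa using h2

theorem BlowsUpAt.of_isFlowLine {G : ℝ → ℂ} {a τ : ℝ} (hτ : 0 < τ)
    (h : IsFlowLine G (Ico a (a + τ))) (hG : ContinuousOn G (Icc a (a + τ)))
    (hend : G (a + τ) = sqrtDriver (a + τ)) :
    BlowsUpAt (fun s => driver (a + s)) (scale * G a) τ := by
  refine Or.inr ⟨hτ, _, h.isLoewnerSolution a fun s hs => ⟨by linarith [hs.1],
    by linarith [hs.2]⟩, ?_⟩
  have hc : ContinuousOn (fun s => ‖scale * G (a + s) - driver (a + s)‖) (Icc 0 τ) := by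
    refine ((continuousOn_const.mul (hG.comp (by fun_prop) fun s hs => ?_)).sub
      (continuous_driver.comp (by fun_prop)).continuousOn).norm
    exact ⟨by linarith [hs.1], by linarith [hs.2]⟩
  have h1 := (hc τ ⟨hτ.le, le_rfl⟩).tendsto.mono_left (nhdsWithin_le_of_mem
        (mem_of_superset (Ioo_mem_nhdsLT hτ) Ioo_subset_Icc_self))
  simpa [hend, driver] using h1


/-! ### Explicit flow lines -/

/-- Splitting the quartic into two quadratics with root sums `A` and `-A` leads to the resolvent
cubic in the hypothesis. The discriminants are `-4 * A * (A - 4 * r) * (A + 2 * r) ^ 2` and the same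
with `r` replaced by `-r`, which explains the square roots in `axisLine` and `sideLine`. -/
theorem quartic_eq_iff {A r m v : ℂ} (hA : A ≠ 0)
    (h : (A ^ 2 - 4 * r ^ 2) ^ 3 = 108 * m ^ 2 * A ^ 2) :
    v ^ 4 - 6 * r ^ 2 * v ^ 2 - 8 * r ^ 3 * v - 3 * r ^ 4 = -27 * m ^ 2 ↔
      2 * A * v ^ 2 - 2 * A ^ 2 * v + A ^ 3 - 6 * A * r ^ 2 - 8 * r ^ 3 = 0 ∨
      2 * A * v ^ 2 + 2 * A ^ 2 * v + A ^ 3 - 6 * A * r ^ 2 + 8 * r ^ 3 = 0 := by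
  have key : (2 * A * v ^ 2 - 2 * A ^ 2 * v + A ^ 3 - 6 * A * r ^ 2 - 8 * r ^ 3) *
      (2 * A * v ^ 2 + 2 * A ^ 2 * v + A ^ 3 - 6 * A * r ^ 2 + 8 * r ^ 3) =
      4 * A ^ 2 * (v ^ 4 - 6 * r ^ 2 * v ^ 2 - 8 * r ^ 3 * v - 3 * r ^ 4 + 27 * m ^ 2) := by
    linear_combination h
  rw [← mul_eq_zero, key, mul_eq_zero, or_iff_right (by simpa using hA)]
  constructor <;> intro h' <;> linear_combination h'

/-- Before time `1` the driver is imaginary; a quarter turn gives the same quartic with real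
coefficients as after time `1`. -/
theorem invariant_of_le (G : ℂ) {t : ℝ} (ht : t ≤ 1) :
    invariant G t = (-Complex.I * G) ^ 4 - 6 * ((√(1 - t) : ℝ) : ℂ) ^ 2 * (-Complex.I * G) ^ 2
      - 8 * ((√(1 - t) : ℝ) : ℂ) ^ 3 * (-Complex.I * G) - 3 * ((√(1 - t) : ℝ) : ℂ) ^ 4 := by
  have h := ofReal_sqrt_sq (sub_nonneg.2 ht)
  rw [invariant, sqrtDriver_of_le ht]
  push_cast at h
  set ρ := ((√(1 - t) : ℝ) : ℂ)
  have ht' : (t : ℂ) - 1 = -ρ ^ 2 := by linear_combination h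
  rw [ht']
  linear_combination (-(Complex.I ^ 2 - 1) * G ^ 4 + 6 * ρ ^ 2 * G ^ 2) * Complex.I_sq

theorem invariant_of_ge (G : ℂ) {t : ℝ} (ht : 1 ≤ t) :
    invariant G t = G ^ 4 - 6 * ((√(t - 1) : ℝ) : ℂ) ^ 2 * G ^ 2
      - 8 * ((√(t - 1) : ℝ) : ℂ) ^ 3 * G - 3 * ((√(t - 1) : ℝ) : ℂ) ^ 4 := by
  have h := ofReal_sqrt_sq (sub_nonneg.2 ht)
  rw [invariant, sqrtDriver_of_ge ht]
  push_cast at h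
  rw [← h]
  ring

theorem rootSum_cubic_of_le (m : ℝ) {t : ℝ} (ht : t ≤ 1) :
    ((rootSum m (t - 1) : ℂ) ^ 2 - 4 * ((√(1 - t) : ℝ) : ℂ) ^ 2) ^ 3 =
      108 * (m : ℂ) ^ 2 * (rootSum m (t - 1) : ℂ) ^ 2 := by
  have h := rootSum_cubic m (t - 1)
  rw [abs_of_nonpos (sub_nonpos.2 ht), neg_sub] at h
  rw [ofReal_sqrt_sq (sub_nonneg.2 ht)]
  exact_mod_cast h

theorem rootSum_cubic_of_ge (m : ℝ) {t : ℝ} (ht : 1 ≤ t) :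
    ((rootSum m (t - 1) : ℂ) ^ 2 - 4 * ((√(t - 1) : ℝ) : ℂ) ^ 2) ^ 3 =
      108 * (m : ℂ) ^ 2 * (rootSum m (t - 1) : ℂ) ^ 2 := by
  have h := rootSum_cubic m (t - 1)
  rw [abs_of_nonneg (sub_nonneg.2 ht)] at h
  rw [ofReal_sqrt_sq (sub_nonneg.2 ht)]
  exact_mod_cast h

/-- The flow lines on the imaginary axis, above (`ε = 1`) and below (`ε = -1`) the driver. They
reach the driver at time `1 - m`. -/
noncomputable def axisLine (ε m t : ℝ) : ℂ :=
  (((rootSum m (t - 1) + ε * ((rootSum m (t - 1) + 2 * √(1 - t)) *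
    √((4 * √(1 - t) - rootSum m (t - 1)) / rootSum m (t - 1)))) / 2 : ℝ) : ℂ) * Complex.I

/-- For `ε = -1`, the flow lines in the right half plane that reach the driver at time `1 + m`.
For `ε = 1`, the complex conjugates of these flow lines from time `1` on. -/
noncomputable def sideLine (ε m t : ℝ) : ℂ :=
  (((rootSum m (t - 1) - 2 * √(1 - t)) *
    √((rootSum m (t - 1) + 4 * √(1 - t)) / rootSum m (t - 1)) / 2 : ℝ) : ℂ) +
  ((ε * ((rootSum m (t - 1) + 2 * √(t - 1)) *
    √((rootSum m (t - 1) - 4 * √(t - 1)) / rootSum m (t - 1))) / 2 : ℝ) : ℂ) * Complex.I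

theorem continuous_axisLine (ε : ℝ) {f g : ℝ → ℝ} (hf : Continuous f) (hg : Continuous g)
    (h : ∀ s, rootSum (f s) (g s - 1) ≠ 0) : Continuous fun s => axisLine ε (f s) (g s) := by
  have hA : Continuous fun s => rootSum (f s) (g s - 1) :=
    continuous_rootSum.comp (hf.prodMk (hg.sub continuous_const))
  unfold axisLine
  fun_prop (disch := assumption)

theorem continuous_sideLine (ε : ℝ) {f g : ℝ → ℝ} (hf : Continuous f) (hg : Continuous g)
    (h : ∀ s, rootSum (f s) (g s - 1) ≠ 0) : Continuous fun s => sideLine ε (f s) (g s) := by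
  have hA : Continuous fun s => rootSum (f s) (g s - 1) :=
    continuous_rootSum.comp (hf.prodMk (hg.sub continuous_const))
  unfold sideLine
  fun_prop (disch := assumption)

theorem ofReal_sqrt_div_sq_mul {a b : ℝ} (ha : 0 ≤ a) (hb : 0 < b) :
    ((√(a / b) : ℝ) : ℂ) ^ 2 * b = a := by
  rw [ofReal_sqrt_sq (div_nonneg ha hb.le)]
  push_cast
  exact div_mul_cancel₀ _ (by exact_mod_cast hb.ne')

theorem invariant_axisLine {ε m t : ℝ} (hε : ε ^ 2 = 1) (ht : t < 1) (hm : |m| ≤ 1 - t) :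
    invariant (axisLine ε m t) t = -27 * (m : ℂ) ^ 2 := by
  have hA : 0 < rootSum m (t - 1) := rootSum_pos (Or.inr (sub_ne_zero.2 ht.ne))
  have habs : |t - 1| = 1 - t := by rw [abs_of_neg (sub_neg.2 ht), neg_sub]
  have hle := rootSum_le (sub_ne_zero.2 ht.ne) (hm.trans habs.ge)
  rw [habs] at hle
  have hS := ofReal_sqrt_div_sq_mul (sub_nonneg.2 hle) hA
  rw [invariant_of_le _ ht.le, quartic_eq_iff (by exact_mod_cast hA.ne')
    (rootSum_cubic_of_le m ht.le)]
  left
  have hε' : (ε : ℂ) ^ 2 = 1 := by exact_mod_cast hε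
  unfold axisLine
  set A := rootSum m (t - 1)
  set ρ := √(1 - t)
  set S := √((4 * ρ - A) / A)
  have hI : ∀ x : ℂ, -Complex.I * (x * Complex.I) = x := fun x => by
    linear_combination -x * Complex.I_sq
  rw [hI]
  push_cast at hS ⊢
  linear_combination ((A : ℂ) + 2 * ρ) ^ 2 / 2 * hS +
    (A : ℂ) * (A + 2 * ρ) ^ 2 * S ^ 2 / 2 * hε'

theorem sideLine_of_le (ε : ℝ) {m t : ℝ} (ht : t ≤ 1) (hA : 0 < rootSum m (t - 1)) :
    sideLine ε m t = (((rootSum m (t - 1) - 2 * √(1 - t)) *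
      √((rootSum m (t - 1) + 4 * √(1 - t)) / rootSum m (t - 1)) / 2 : ℝ) : ℂ) +
      ((ε * rootSum m (t - 1) / 2 : ℝ) : ℂ) * Complex.I := by
  rw [sideLine, Real.sqrt_eq_zero_of_nonpos (sub_nonpos.2 ht)]
  simp [div_self hA.ne']

theorem sideLine_of_ge (ε : ℝ) {m t : ℝ} (ht : 1 ≤ t) (hA : 0 < rootSum m (t - 1)) :
    sideLine ε m t = ((rootSum m (t - 1) / 2 : ℝ) : ℂ) +
      ((ε * ((rootSum m (t - 1) + 2 * √(t - 1)) *
      √((rootSum m (t - 1) - 4 * √(t - 1)) / rootSum m (t - 1))) / 2 : ℝ) : ℂ) * Complex.I := by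
  rw [sideLine, Real.sqrt_eq_zero_of_nonpos (sub_nonpos.2 ht)]
  simp [div_self hA.ne']

theorem invariant_sideLine_of_le {m t : ℝ} (hm : m ≠ 0) (ht : t ≤ 1) :
    invariant (sideLine (-1) m t) t = -27 * (m : ℂ) ^ 2 := by
  have hA : 0 < rootSum m (t - 1) := rootSum_pos (Or.inl hm)
  have hS := ofReal_sqrt_div_sq_mul (a := rootSum m (t - 1) + 4 * √(1 - t)) (by positivity) hA
  rw [invariant_of_le _ ht, quartic_eq_iff (by exact_mod_cast hA.ne') (rootSum_cubic_of_le m ht),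
    sideLine_of_le _ ht hA]
  right
  set A := rootSum m (t - 1)
  set ρ := √(1 - t)
  set S := √((A + 4 * ρ) / A)
  push_cast at hS ⊢
  have hI : ∀ x y : ℂ, -Complex.I * (x + y * Complex.I) = y - Complex.I * x := fun x y => by
    linear_combination -y * Complex.I_sq
  rw [hI]
  linear_combination -((A : ℂ) - 2 * ρ) ^ 2 / 2 * hS +
    (A : ℂ) * (A - 2 * ρ) ^ 2 * S ^ 2 / 2 * Complex.I_sq

theorem invariant_sideLine_of_ge {ε m t : ℝ} (hε : ε ^ 2 = 1) (hm : m ≠ 0) (ht : 1 ≤ t)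
    (htm : t - 1 ≤ |m|) : invariant (sideLine ε m t) t = -27 * (m : ℂ) ^ 2 := by
  have hA : 0 < rootSum m (t - 1) := rootSum_pos (Or.inl hm)
  have habs : |t - 1| = t - 1 := abs_of_nonneg (sub_nonneg.2 ht)
  have hle := le_rootSum hm (habs.le.trans htm)
  rw [habs] at hle
  have hS := ofReal_sqrt_div_sq_mul (sub_nonneg.2 hle) hA
  rw [invariant_of_ge _ ht, quartic_eq_iff (by exact_mod_cast hA.ne') (rootSum_cubic_of_ge m ht),
    sideLine_of_ge _ ht hA]
  left
  have hε' : (ε : ℂ) ^ 2 = 1 := by exact_mod_cast hε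
  set A := rootSum m (t - 1)
  set r := √(t - 1)
  set S := √((A - 4 * r) / A)
  push_cast at hS ⊢
  linear_combination -((A : ℂ) + 2 * r) ^ 2 / 2 * hS +
    (A : ℂ) * (A + 2 * r) ^ 2 * S ^ 2 / 2 * (Complex.I ^ 2 * hε' + Complex.I_sq)

theorem axisLine_eq_sqrtDriver (ε : ℝ) {m : ℝ} (hm : 0 < m) :
    axisLine ε m (1 - m) = sqrtDriver (1 - m) := by
  have h : rootSum m (1 - m - 1) = 4 * √m := by
    rw [rootSum_eq (by linarith : (1 - m - 1 : ℝ) ≠ 0 ) (by rw [← abs_neg]; congr 1; ring)]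
    congr 2
    rw [show 1 - m - 1 = -m by ring, abs_neg, abs_of_pos hm]
  rw [axisLine, h, sqrtDriver_of_le (by linarith), sub_sub_cancel]
  push_cast
  simp
  ring

theorem sideLine_eq_sqrtDriver (ε : ℝ) {m : ℝ} (hm : 0 < m) :
    sideLine ε m (1 + m) = sqrtDriver (1 + m) := by
  have h : rootSum m (1 + m - 1) = 4 * √m := by
    rw [add_sub_cancel_left, rootSum_eq hm.ne' rfl, abs_of_pos hm]
  have hA : 0 < rootSum m (1 + m - 1) := rootSum_pos (Or.inl hm.ne')
  rw [sideLine_of_ge _ (by linarith) hA, h, sqrtDriver_of_ge (by linarith), add_sub_cancel_left]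
  push_cast
  simp
  ring

theorem axisLine_zero {ε t : ℝ} (ht : t < 1) :
    axisLine ε 0 t = (1 / 2 + ε) * sqrtDriver t := by
  have hρ : 0 < √(1 - t) := Real.sqrt_pos.2 (sub_pos.2 ht)
  have h : rootSum 0 (t - 1) = 2 * √(1 - t) := by
    rw [rootSum_zero_left, abs_of_neg (sub_neg.2 ht), neg_sub]
  rw [axisLine, h, sqrtDriver_of_le ht.le, show (4 * √(1 - t) - 2 * √(1 - t)) = 2 * √(1 - t) by ring,
    div_self (by positivity)]
  push_cast
  simp
  ring

theorem sideLine_re_pos (ε : ℝ) {m t : ℝ} (hm : m ≠ 0) (ht : t ≤ 1) :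
    0 < (sideLine ε m t).re := by
  have hA : 0 < rootSum m (t - 1) := rootSum_pos (Or.inl hm)
  have hlt := two_mul_sqrt_lt_rootSum hm (t - 1)
  rw [abs_of_nonpos (sub_nonpos.2 ht), neg_sub] at hlt
  have : 0 < √((rootSum m (t - 1) + 4 * √(1 - t)) / rootSum m (t - 1)) :=
    Real.sqrt_pos.2 (by positivity)
  have h2 := mul_pos (sub_pos.2 hlt) this
  rw [sideLine_of_le _ ht hA]
  simpa using h2

theorem ne_sqrtDriver_of_invariant {G : ℂ} {m t : ℝ} (h : invariant G t = -27 * (m : ℂ) ^ 2)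
    (hm : |t - 1| ≠ |m|) : G ≠ sqrtDriver t := by
  rintro rfl
  rw [invariant_sqrtDriver] at h
  have h1 : ((t : ℂ) - 1) ^ 2 = (m : ℂ) ^ 2 := by linear_combination -h / 27
  have h2 : (t - 1) ^ 2 = m ^ 2 := by exact_mod_cast h1
  exact hm (sq_eq_sq_iff_abs_eq_abs _ _ |>.1 h2)

theorem isFlowLine_of_invariant {G : ℝ → ℂ} {S : Set ℝ} {m : ℝ} (hm : m ≠ 0)
    (hG : ContinuousOn G S) (hC : ∀ t ∈ S, invariant (G t) t = -27 * (m : ℂ) ^ 2)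
    (h1 : ∀ t ∈ S, G t ≠ sqrtDriver t) : IsFlowLine G S := by
  refine IsFlowLine.of_invariant hG hC h1 fun t ht h0 => ?_
  have h2 := hC t ht
  rw [invariant_eq_zero h0] at h2
  have h3 : (m : ℂ) ^ 2 = 0 := by linear_combination h2 / 27
  exact hm (by exact_mod_cast pow_eq_zero_iff two_ne_zero |>.1 h3)

theorem isFlowLine_axisLine {ε m : ℝ} (hε : ε ^ 2 = 1) (hm0 : 0 ≤ m) :
    IsFlowLine (axisLine ε m) (Ico 0 (1 - m)) := by
  -- At level zero, `ε = -1` runs through the critical points `2 * G + sqrtDriver = 0`, so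
  -- `IsFlowLine.of_invariant` does not apply. Here the lines are multiples `c * sqrtDriver`, which
  -- solve the equation when `c * (c - 1) = 3 / 4`, that is `c = 1 / 2 ± 1`.
  rcases hm0.eq_or_lt with rfl | hm
  · intro t ht
    rw [sub_zero] at ht ⊢
    have h0 := sqrtDriver_ne_zero ht.2.ne
    have hε' : (ε : ℂ) ^ 2 = 1 := by exact_mod_cast hε
    have hε1 : (1 / 2 + ε : ℂ) - 1 ≠ 0 := by
      intro h
      have : (ε : ℂ) = 1 / 2 := by linear_combination h
      rw [this] at hε'
      norm_num at hε'
    have e : axisLine ε 0 t - sqrtDriver t = ((1 / 2 + ε : ℂ) - 1) * sqrtDriver t := by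
      rw [axisLine_zero ht.2]
      ring
    refine ⟨sub_ne_zero.1 (e ▸ mul_ne_zero hε1 h0), ?_⟩
    rw [e]
    have hd := ((hasDerivAt_sqrtDriver ht.2.ne).const_mul (1 / 2 + ε : ℂ)).hasDerivWithinAt
      (s := Ico 0 1)
    refine (hd.congr (fun s hs => axisLine_zero hs.2) (axisLine_zero ht.2)).congr_deriv ?_
    rw [eq_div_iff (mul_ne_zero hε1 h0)]
    field_simp
    linear_combination 4 * hε'
  · have hinv : ∀ t ∈ Ico 0 (1 - m), invariant (axisLine ε m t) t = -27 * (m : ℂ) ^ 2 :=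
      fun t ht => invariant_axisLine hε (by linarith [ht.2]) (by
        rw [abs_of_pos hm]; linarith [ht.2])
    refine isFlowLine_of_invariant hm.ne' (continuous_axisLine ε continuous_const continuous_id
      fun _ => (rootSum_pos (Or.inl hm.ne')).ne').continuousOn hinv fun t ht =>
      ne_sqrtDriver_of_invariant (hinv t ht) ?_
    rw [abs_of_pos hm, abs_of_neg (by linarith [ht.2])]
    linarith [ht.2]

theorem isFlowLine_sideLine {m : ℝ} (hm : 0 < m) :
    IsFlowLine (sideLine (-1) m) (Ico 0 (1 + m)) := by
  have hinv : ∀ t ∈ Ico 0 (1 + m), invariant (sideLine (-1) m t) t = -27 * (m : ℂ) ^ 2 := by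
    intro t ht
    rcases le_total t 1 with h | h
    · exact invariant_sideLine_of_le hm.ne' h
    · exact invariant_sideLine_of_ge (by norm_num) hm.ne' h (by
        rw [abs_of_pos hm]; linarith [ht.2])
  refine isFlowLine_of_invariant hm.ne' (continuous_sideLine _ continuous_const continuous_id
    fun _ => (rootSum_pos (Or.inl hm.ne')).ne').continuousOn hinv fun t ht => ?_
  -- The invariant alone cannot exclude a collision at `1 - m`, where the driver lies on the same
  -- level; up to time `1` the positive real part does.
  rcases le_or_gt t 1 with h | h
  · intro heq
    have h1 := sideLine_re_pos (-1) hm.ne' h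
    rw [heq, sqrtDriver_re_of_le h] at h1
    exact lt_irrefl _ h1
  · refine ne_sqrtDriver_of_invariant (hinv t ht) ?_
    rw [abs_of_pos hm, abs_of_pos (by linarith)]
    linarith [ht.2]

theorem isFlowLine_sideLine_conj {m : ℝ} (hm : 0 < m) :
    IsFlowLine (sideLine 1 m) (Ico 1 (1 + m)) := by
  have hinv : ∀ t ∈ Ico 1 (1 + m), invariant (sideLine 1 m t) t = -27 * (m : ℂ) ^ 2 :=
    fun t ht => invariant_sideLine_of_ge (by norm_num) hm.ne' ht.1 (by
      rw [abs_of_pos hm]; linarith [ht.2])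
  refine isFlowLine_of_invariant hm.ne' (continuous_sideLine _ continuous_const continuous_id
    fun _ => (rootSum_pos (Or.inl hm.ne')).ne').continuousOn hinv fun t ht =>
    ne_sqrtDriver_of_invariant (hinv t ht) ?_
  rw [abs_of_pos hm, abs_of_nonneg (by linarith [ht.1])]
  linarith [ht.2]

theorem blowsUpAt_axisLine {ε m : ℝ} (hε : ε ^ 2 = 1) (hm0 : 0 ≤ m) (hm1 : m ≤ 1) :
    BlowsUpAt driver (scale * axisLine ε m 0) (1 - m) := by
  rcases hm1.eq_or_lt with rfl | hm1
  · refine Or.inl ⟨sub_self 1, ?_⟩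
    have := axisLine_eq_sqrtDriver ε one_pos
    rw [sub_self] at this
    rw [this, driver]
  have hflow := isFlowLine_axisLine hε hm0
  rcases hm0.eq_or_lt with rfl | hm
  · rw [sub_zero] at hflow ⊢
    -- For `m = 0` the formula for `axisLine` divides by zero at the collision time `1`; the
    -- multiple of the driver extends it continuously.
    set G : ℝ → ℂ := fun t => (1 / 2 + ε) * sqrtDriver t with hGdef
    have hG : IsFlowLine G (Ico 0 1) := by
      intro t ht
      have := hflow t ht
      rw [axisLine_zero ht.2] at this
      exact ⟨this.1, this.2.congr (fun s hs => (axisLine_zero hs.2).symm)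
        (axisLine_zero ht.2).symm⟩
    have := BlowsUpAt.of_isFlowLine (G := G) (a := 0) one_pos (by simpa using hG)
      (continuous_const.mul continuous_sqrtDriver).continuousOn
      (by simp [hGdef, sqrtDriver_one])
    simpa [hGdef, axisLine_zero] using this
  · have := BlowsUpAt.of_isFlowLine (a := 0) (sub_pos.2 hm1) (by simpa using hflow)
      (continuous_axisLine ε continuous_const continuous_id
      fun _ => (rootSum_pos (Or.inl hm.ne')).ne').continuousOn
      (by simpa using axisLine_eq_sqrtDriver ε hm)
    simpa using this

theorem blowsUpAt_sideLine {m : ℝ} (hm : 0 < m) :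
    BlowsUpAt driver (scale * sideLine (-1) m 0) (1 + m) := by
  have := BlowsUpAt.of_isFlowLine (a := 0) (by linarith : 0 < 1 + m)
    (by simpa using isFlowLine_sideLine hm)
    (continuous_sideLine _ continuous_const continuous_id
      fun _ => (rootSum_pos (Or.inl hm.ne')).ne').continuousOn
    (by simpa using sideLine_eq_sqrtDriver (-1) hm)
  simpa using this

theorem blowsUpAt_sideLine_conj {m : ℝ} (hm : 0 < m) :
    BlowsUpAt (fun s => driver (1 + s)) (scale * sideLine 1 m 1) m :=
  BlowsUpAt.of_isFlowLine hm (isFlowLine_sideLine_conj hm)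
    (continuous_sideLine _ continuous_const continuous_id
      fun _ => (rootSum_pos (Or.inl hm.ne')).ne').continuousOn
    (sideLine_eq_sqrtDriver 1 hm)

/-! ### Initial points with a given value of the conserved quantity -/

theorem two_le_rootSum (m : ℝ) : 2 ≤ rootSum m (0 - 1) := by
  simpa using two_mul_sqrt_le_rootSum m (0 - 1)

theorem rootSum_le_four {m : ℝ} (hm : |m| ≤ 1) : rootSum m (0 - 1) ≤ 4 := by
  simpa using rootSum_le (m := m) (x := 0 - 1) (by norm_num) (by simpa using hm)

theorem rootSum_lt_four {m : ℝ} (hm : |m| < 1) : rootSum m (0 - 1) < 4 := by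
  refine lt_of_le_of_ne (rootSum_le_four hm.le) fun h => ?_
  have h1 := rootSum_cubic m (0 - 1)
  rw [h] at h1
  norm_num at h1
  have h2 : m ^ 2 = 1 := by linarith
  have h3 := (sq_lt_one_iff_abs_lt_one m).2 hm
  linarith

/-- At time `0` the bounds `2 ≤ rootSum ≤ 4` make the first quadratic factor contribute two points
on the axis, and the second a pair symmetric about the axis. -/
theorem initial_cases {ζ : ℂ} {m : ℝ} (hm0 : 0 ≤ m) (hm1 : m ≤ 1)
    (h : invariant ζ 0 = -27 * (m : ℂ) ^ 2) :
    ζ = axisLine 1 m 0 ∨ ζ = axisLine (-1) m 0 ∨ ζ = sideLine (-1) m 0 ∨ ζ.re < 0 := by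
  have hA2 := two_le_rootSum m
  have hA4 := rootSum_le_four ((abs_of_nonneg hm0).trans_le hm1)
  have hA : 0 < rootSum m (0 - 1) := by linarith
  have hA' : (rootSum m (0 - 1) : ℂ) ≠ 0 := by exact_mod_cast hA.ne'
  rw [invariant_of_le _ zero_le_one,
    quartic_eq_iff hA' (rootSum_cubic_of_le m zero_le_one)] at h
  rw [sideLine_of_le _ zero_le_one hA]
  unfold axisLine
  simp only [sub_zero, Real.sqrt_one, Complex.ofReal_one, one_pow, mul_one] at h ⊢
  set A := rootSum m (0 - 1)
  have hS := ofReal_sqrt_div_sq_mul (sub_nonneg.2 hA4) hA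
  have hS' := ofReal_sqrt_div_sq_mul (a := A + 4) (by linarith) hA
  have hS0 : 0 < √((A + 4) / A) := Real.sqrt_pos.2 (by positivity)
  set S := √((4 - A) / A)
  set S' := √((A + 4) / A)
  have hζ : ζ = (-Complex.I * ζ) * Complex.I := by linear_combination ζ * Complex.I_sq
  set v := -Complex.I * ζ
  push_cast at hS hS'
  rcases h with h | h
  · have h1 : (2 * v - A) ^ 2 = ((A + 2) * S : ℂ) ^ 2 := by
      refine mul_left_cancel₀ hA' ?_
      linear_combination 2 * h - (A + 2 : ℂ) ^ 2 * hS
    rcases sq_eq_sq_iff_eq_or_eq_neg.1 h1 with h2 | h2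
    · left
      rw [hζ]
      push_cast
      linear_combination Complex.I / 2 * h2
    · right; left
      rw [hζ]
      push_cast
      linear_combination Complex.I / 2 * h2
  · have h1 : (2 * v + A) ^ 2 = (Complex.I * ((A - 2) * S') : ℂ) ^ 2 := by
      refine mul_left_cancel₀ hA' ?_
      rw [mul_pow, Complex.I_sq]
      linear_combination 2 * h + (A - 2 : ℂ) ^ 2 * hS'
    right; right
    rcases sq_eq_sq_iff_eq_or_eq_neg.1 h1 with h2 | h2
    · have h3 : ζ = ((-((A - 2) * S') / 2 : ℝ) : ℂ) + ((-1 * A / 2 : ℝ) : ℂ) * Complex.I := by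
        rw [hζ]
        push_cast
        linear_combination Complex.I / 2 * h2 + (A - 2 : ℂ) * S' / 2 * Complex.I_sq
      -- When the root sum is `2` the symmetric pair merges on the axis, so the reflected root is
      -- again `sideLine`.
      rcases hA2.eq_or_lt with h4 | h4
      · left
        rw [h3, ← h4]
        simp
      · right
        have h5 := mul_pos (sub_pos.2 h4) hS0
        rw [h3]
        simp only [Complex.add_re, Complex.ofReal_re, Complex.mul_re, Complex.I_re,
          Complex.ofReal_im, Complex.I_im]
        linarith
    · left
      rw [hζ]
      push_cast
      linear_combination Complex.I / 2 * h2 - (A - 2 : ℂ) * S' / 2 * Complex.I_sq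

theorem sideLine_zero : sideLine (-1) 0 0 = axisLine (-1) 0 0 := by
  have hA : rootSum 0 (0 - 1) = 2 := by simp [rootSum_zero_left]
  rw [sideLine_of_le _ zero_le_one (by rw [hA]; norm_num), axisLine, hA]
  simp
  norm_num


/-! ### The two-sided curve -/

/-- The two-sided curve: it follows the imaginary axis for `t ≤ 1` and turns into the right half
plane at time `1`. -/
noncomputable def curve (t : ℝ) : ℂ :=
  scale * if t ≤ -1 then axisLine 1 0 0 else if t ≤ 0 then axisLine 1 (1 + t) 0
    else if t ≤ 1 then axisLine (-1) (1 - t) 0 else sideLine (-1) (t - 1) 0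

theorem curve_of_le_neg_one {t : ℝ} (h : t ≤ -1) : curve t = scale * axisLine 1 0 0 := by
  rw [curve, if_pos h]

theorem curve_of_nonpos {t : ℝ} (h : -1 ≤ t) (h' : t ≤ 0) :
    curve t = scale * axisLine 1 (1 + t) 0 := by
  rcases h.eq_or_lt with rfl | h
  · simp [curve]
  · rw [curve, if_neg (not_le.2 h), if_pos h']

theorem curve_of_nonneg {t : ℝ} (h : 0 ≤ t) (h' : t ≤ 1) :
    curve t = scale * axisLine (-1) (1 - t) 0 := by
  rcases h.eq_or_lt with rfl | h
  · have h1 := axisLine_eq_sqrtDriver 1 one_pos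
    have h2 := axisLine_eq_sqrtDriver (-1) one_pos
    rw [sub_self] at h1 h2
    rw [curve_of_nonpos (by norm_num) le_rfl, add_zero, sub_zero, h1, h2]
  · rw [curve, if_neg (by linarith), if_neg (not_le.2 h), if_pos h']

theorem curve_of_gt {t : ℝ} (h : 1 < t) : curve t = scale * sideLine (-1) (t - 1) 0 := by
  rw [curve, if_neg (by linarith), if_neg (by linarith), if_neg (not_le.2 h)]

theorem continuous_curve : Continuous curve := by
  have hA : ∀ m, rootSum m (0 - 1) ≠ 0 := fun m => (rootSum_pos (Or.inr (by norm_num))).ne'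
  have h1 := axisLine_eq_sqrtDriver 1 one_pos
  have h2 := axisLine_eq_sqrtDriver (-1) one_pos
  rw [sub_self] at h1 h2
  refine continuous_const.mul (Continuous.if_le continuous_const (Continuous.if_le
    (continuous_axisLine 1 (by fun_prop) continuous_const fun _ => hA _) (Continuous.if_le
    (continuous_axisLine (-1) (by fun_prop) continuous_const fun _ => hA _)
    (continuous_sideLine (-1) (by fun_prop) continuous_const fun _ => hA _)
    continuous_id continuous_const ?_) continuous_id continuous_const ?_)
    continuous_id continuous_const ?_)
  · rintro t rfl
    rw [sub_self, sideLine_zero]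
  · rintro t rfl
    rw [add_zero, sub_zero, if_pos zero_le_one, h1, h2]
  · rintro t rfl
    rw [if_pos (by norm_num), add_neg_cancel]

theorem blowsUpAt_curve {t : ℝ} (h1 : -1 ≤ t) : BlowsUpAt driver (curve t) |t| := by
  rcases le_total t 0 with h | h
  · have := blowsUpAt_axisLine (ε := 1) (m := 1 + t) (by norm_num) (by linarith) (by linarith)
    rwa [← curve_of_nonpos h1 h, sub_add_cancel_left, ← abs_of_nonpos h] at this
  · rw [abs_of_nonneg h]
    rcases le_or_gt t 1 with h' | h'
    · have := blowsUpAt_axisLine (ε := -1) (m := 1 - t) (by norm_num) (by linarith) (by linarith)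
      rwa [← curve_of_nonneg h h', sub_sub_cancel] at this
    · have := blowsUpAt_sideLine (m := t - 1) (by linarith)
      rwa [← curve_of_gt h', add_sub_cancel] at this

theorem IsFlowLine.invariant_tendsto {G : ℝ → ℂ} {τ : ℝ} (hτ : 0 < τ)
    (h : IsFlowLine G (Ico 0 τ)) (hlim : Tendsto (fun s => G s - sqrtDriver s) (𝓝[<] τ) (𝓝 0)) :
    invariant (G 0) 0 = -27 * ((τ : ℂ) - 1) ^ 2 := by
  have hid : Tendsto (fun s : ℝ => s) (𝓝[<] τ) (𝓝 τ) := tendsto_id.mono_left nhdsWithin_le_nhds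
  have hD : Tendsto sqrtDriver (𝓝[<] τ) (𝓝 (sqrtDriver τ)) :=
    (continuous_sqrtDriver.tendsto τ).comp hid
  have hG : Tendsto G (𝓝[<] τ) (𝓝 (sqrtDriver τ)) := by
    simpa using hlim.add hD
  have hpair : Tendsto (fun s => (G s, s)) (𝓝[<] τ) (𝓝 (sqrtDriver τ, τ)) := hG.prodMk_nhds hid
  have hc : Tendsto (fun p : ℂ × ℝ => invariant p.1 p.2) (𝓝 (sqrtDriver τ, τ))
      (𝓝 (invariant (sqrtDriver τ) τ)) := continuous_invariant.tendsto (sqrtDriver τ, τ)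
  have hinv : Tendsto (fun s => invariant (G s) s) (𝓝[<] τ) (𝓝 (invariant (sqrtDriver τ) τ)) :=
    Tendsto.comp (f := fun s => (G s, s)) hc hpair
  have hconst : (fun s => invariant (G s) s) =ᶠ[𝓝[<] τ] fun _ => invariant (G 0) 0 := by
    filter_upwards [Ioo_mem_nhdsLT hτ] with s hs
    have hs' : IsFlowLine G (Icc 0 s) := h.mono fun r hr => ⟨hr.1, hr.2.trans_lt hs.2⟩
    exact hs'.invariant_eq ⟨hs.1.le, le_rfl⟩
  have hlim' := hinv.congr' hconst
  exact (tendsto_nhds_unique tendsto_const_nhds hlim').trans (invariant_sqrtDriver τ)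

/-- The invariant determines only `|τ - 1|`. Uniqueness of blow-up times settles its sign for points
on the axis. Off the axis, the barriers exclude the left half plane and force `τ > 1` in the right
one. -/
theorem eq_curve_of_blowsUpAt {z : ℂ} {τ : ℝ} (h : BlowsUpAt driver z τ) (hτ2 : τ ≤ 2) :
    z = curve τ ∨ z = curve (-τ) := by
  have h' := h
  rcases h' with ⟨rfl, rfl⟩ | ⟨hτ, g, hg, hlim⟩
  · left
    have h1 := axisLine_eq_sqrtDriver (-1) one_pos
    rw [sub_self] at h1
    rw [curve_of_nonneg le_rfl zero_le_one, sub_zero, h1, driver]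
  have hb := scale_ne_zero
  have hflow := hg.isFlowLine
  set G : ℝ → ℂ := fun t => scale⁻¹ * g t with hGdef
  have hz : z = scale * G 0 := hg.1.symm.trans (mul_inv_cancel_left₀ hb (g 0)).symm
  have hlimG : Tendsto (fun s => G s - sqrtDriver s) (𝓝[<] τ) (𝓝 0) := by
    have h1 := (tendsto_zero_iff_norm_tendsto_zero.2 hlim).const_mul scale⁻¹
    rw [mul_zero] at h1
    refine h1.congr fun s => ?_
    rw [hGdef, driver]
    field_simp
  have hre : Tendsto (fun s => (G s).re - (sqrtDriver s).re) (𝓝[<] τ) (𝓝 0) := by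
    simpa [Function.comp_def] using (Complex.continuous_re.tendsto 0).comp hlimG
  have hIcc : ∀ s < τ, IsFlowLine G (Icc 0 s) := fun s hs =>
    hflow.mono fun r hr => ⟨hr.1, hr.2.trans_lt hs⟩
  have hright : 0 < (G 0).re → 1 < τ := by
    intro hpos
    by_contra! hle
    have : (G 0).re / 2 ≤ 0 := ge_of_tendsto hre (by
      filter_upwards [Ioo_mem_nhdsLT hτ] with s hs
      rw [sqrtDriver_re_of_le (hs.2.le.trans hle), sub_zero]
      exact (hIcc s hs.2).le_re (hs.2.le.trans hle) hpos ⟨hs.1.le, le_rfl⟩)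
    linarith
  have hleft : ¬ (G 0).re < 0 := by
    intro hneg
    have : 0 ≤ (G 0).re / 2 := le_of_tendsto hre (by
      filter_upwards [Ioo_mem_nhdsLT hτ] with s hs
      have h1 := (hIcc s hs.2).re_le hneg ⟨hs.1.le, le_rfl⟩
      have h2 := sqrtDriver_re_nonneg s
      linarith)
    linarith
  have hinv := hflow.invariant_tendsto hτ hlimG
  have hm1 : |τ - 1| ≤ 1 := abs_le.2 ⟨by linarith, by linarith⟩
  have hm0 := abs_nonneg (τ - 1)
  have hsq : ((|τ - 1| : ℝ) : ℂ) ^ 2 = ((τ : ℂ) - 1) ^ 2 := by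
    have := sq_abs (τ - 1)
    exact_mod_cast this
  rw [← hsq] at hinv
  have haxis : ∀ ε : ℝ, ε ^ 2 = 1 → G 0 = axisLine ε |τ - 1| 0 → |τ - 1| = 1 - τ := by
    intro ε hε heq
    have h1 := blowsUpAt_axisLine hε hm0 hm1
    rw [← heq, ← hz] at h1
    linarith [h1.unique continuous_driver h]
  rcases initial_cases hm0 hm1 hinv with heq | heq | heq | hneg
  · right
    have h1 := haxis 1 (by norm_num) heq
    rw [hz, heq, curve_of_nonpos (by linarith) (by linarith), h1, ← sub_eq_add_neg]
  · left
    have h1 := haxis (-1) (by norm_num) heq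
    rw [hz, heq, curve_of_nonneg hτ.le (by linarith), h1]
  · left
    rcases hm0.eq_or_lt with hm | hm
    · have hτ1 : τ = 1 := by
        have := abs_eq_zero.1 hm.symm
        linarith
      rw [hz, heq, hτ1, curve_of_nonneg zero_le_one le_rfl, sub_self, abs_zero, sideLine_zero]
    · have hτ1 : 1 < τ := hright (by rw [heq]; exact sideLine_re_pos _ hm.ne' zero_le_one)
      rw [hz, heq, curve_of_gt hτ1, abs_of_pos (by linarith)]
  · exact absurd hneg hleft

theorem createsTwoSidedCurve : CreatesTwoSidedCurve driver 2 curve := by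
  refine ⟨continuous_curve.continuousOn, fun t ht => Subset.antisymm (fun z hz => ?_) ?_⟩
  · obtain ⟨τ, hτt, hτ⟩ := exists_blowsUpAt_of_mem_leftHull continuous_driver hz
    have h0 := hτ.nonneg
    rcases eq_curve_of_blowsUpAt hτ (hτt.trans ht.2) with rfl | rfl
    · exact ⟨τ, ⟨by linarith, hτt⟩, rfl⟩
    · exact ⟨-τ, ⟨by linarith, by linarith⟩, rfl⟩
  · rintro _ ⟨u, hu, rfl⟩
    rcases le_total (-1) u with h | h
    · exact (blowsUpAt_curve h).mem_leftHull (abs_le.2 hu)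
    · rw [curve_of_le_neg_one h, ← curve_of_le_neg_one le_rfl]
      exact (blowsUpAt_curve le_rfl).mem_leftHull (by
        rw [abs_neg, abs_one]
        linarith [hu.1])

theorem curve_ne_of_mem_Ioc {t : ℝ} (h0 : 0 < t) (h1 : t ≤ 1) : curve (-t) ≠ curve t := by
  intro heq
  rw [curve_of_nonpos (by linarith) (by linarith), curve_of_nonneg h0.le h1,
    ← sub_eq_add_neg] at heq
  have hA := two_le_rootSum (1 - t)
  have hA4 := rootSum_lt_four (m := 1 - t) (abs_lt.2 ⟨by linarith, by linarith⟩)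
  have h2 := congrArg Complex.im (mul_left_cancel₀ scale_ne_zero heq)
  simp only [axisLine, Complex.mul_im, Complex.ofReal_re, Complex.ofReal_im, Complex.I_re,
    Complex.I_im, sub_zero, Real.sqrt_one] at h2
  have hS : 0 < √((4 * 1 - rootSum (1 - t) (0 - 1)) / rootSum (1 - t) (0 - 1)) :=
    Real.sqrt_pos.2 (div_pos (by linarith) (by linarith))
  have h3 := mul_pos (by linarith : 0 < rootSum (1 - t) (0 - 1) + 2 * 1) hS
  linarith

/-- The point at parameter `t` is absorbed at time `|t|`, so a coincidence could only occur between
`t` and `-t`, where the two axis points are distinct. -/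
theorem injOn_curve : InjOn curve (Icc (-1) 2) := by
  intro a ha b hb heq
  have h1 := blowsUpAt_curve ha.1
  rw [heq] at h1
  rcases abs_eq_abs.1 (h1.unique continuous_driver (blowsUpAt_curve hb.1)) with h | h
  · exact h
  · subst h
    rcases lt_trichotomy b 0 with h0 | rfl | h0
    · have := curve_ne_of_mem_Ioc (t := -b) (by linarith) (by linarith [hb.1])
      rw [neg_neg] at this
      exact absurd heq.symm this
    · exact neg_zero
    · exact absurd heq (curve_ne_of_mem_Ioc h0 (by linarith [ha.1]))

theorem curve_eq_of_le_neg_one {u : ℝ} (hu : u ≤ -1) : curve u = curve (-1) := by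
  rw [curve_of_le_neg_one hu, curve_of_le_neg_one le_rfl]

theorem isSimpleTwoSidedCurve : IsSimpleTwoSidedCurve 2 curve := by
  intro a ha b hb hab heq u hu
  rcases le_total (-1) a with h | h
  · have hab' : a = b := injOn_curve ⟨h, ha.2⟩ ⟨h.trans hab, hb.2⟩ heq
    subst hab'
    rw [le_antisymm hu.2 hu.1]
  · have hb1 : b ≤ -1 := by
      by_contra! hlt
      rw [curve_eq_of_le_neg_one h] at heq
      have := injOn_curve ⟨le_rfl, by norm_num⟩ ⟨hlt.le, hb.2⟩ heq
      linarith
    rw [curve_eq_of_le_neg_one h, curve_eq_of_le_neg_one (hu.2.trans hb1)]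

/-! ### The right hull at time `1` -/

/-- Any preimage has invariant `-27`, which leaves three kinds of candidates: the initial driving
point, already absorbed; the right point, which flows to the complex conjugate instead; and a point
in the left half plane, which stays there. -/
theorem sideLine_conj_mem_rightHull : scale * sideLine 1 1 1 ∈ rightHull driver 1 := by
  rintro ⟨z, hz, g, hg, hg1⟩
  have hb := scale_ne_zero
  have hflow := hg.isFlowLine
  set G : ℝ → ℂ := fun t => scale⁻¹ * g t with hGdef
  have hz0 : z = scale * G 0 := hg.1.symm.trans (mul_inv_cancel_left₀ hb (g 0)).symm
  have hG1 : G 1 = sideLine 1 1 1 := by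
    change scale⁻¹ * g 1 = _
    rw [hg1, inv_mul_cancel_left₀ hb]
  have hinv : invariant (G 0) 0 = -27 * ((1 : ℝ) : ℂ) ^ 2 := by
    rw [← hflow.invariant_eq (right_mem_Icc.2 zero_le_one), hG1]
    exact invariant_sideLine_of_ge (by norm_num) one_ne_zero le_rfl (by simp)
  have haxis : ∀ ε : ℝ, ε ^ 2 = 1 → G 0 ≠ axisLine ε 1 0 := by
    intro ε hε heq
    have h1 := blowsUpAt_axisLine hε zero_le_one le_rfl
    rw [← heq, ← hz0] at h1
    exact hz (h1.mem_leftHull (by norm_num))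
  rcases initial_cases zero_le_one le_rfl hinv with heq | heq | heq | hneg
  · exact haxis 1 (by norm_num) heq
  · exact haxis (-1) (by norm_num) heq
  · have hk : IsLoewnerSolution driver z (Icc 0 1) (fun s => scale * sideLine (-1) 1 s) := by
      have := (isFlowLine_sideLine one_pos).isLoewnerSolution (I := Icc 0 1) 0
        fun s hs => ⟨by linarith [hs.1], by linarith [hs.2]⟩
      simpa [hz0, heq] using this
    have h1 := hg.eqOn continuous_driver hk (right_mem_Icc.2 zero_le_one)
    rw [hg1] at h1
    have hA : 0 < rootSum 1 (1 - 1) := rootSum_pos (Or.inl one_ne_zero)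
    have h2 := congrArg Complex.im (mul_left_cancel₀ hb h1)
    rw [sideLine_of_le _ le_rfl hA, sideLine_of_le _ le_rfl hA] at h2
    simp only [Complex.add_im, Complex.mul_im, Complex.ofReal_re, Complex.ofReal_im, Complex.I_re,
      Complex.I_im] at h2
    generalize rootSum 1 (1 - 1) = A at hA h2
    linarith
  · have h1 := hflow.re_le hneg (right_mem_Icc.2 zero_le_one)
    rw [hG1] at h1
    have h2 := sideLine_re_pos 1 one_ne_zero (le_refl (1 : ℝ))
    linarith

theorem not_hullsMeetOnlyAtDriver : ¬ HullsMeetOnlyAtDriver driver 2 := by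
  intro h
  have hmem : scale * sideLine 1 1 1 ∈ ({driver 1} : Set ℂ) := by
    rw [← h 1 1 zero_le_one zero_le_one (by norm_num)]
    exact ⟨(blowsUpAt_sideLine_conj one_pos).mem_leftHull le_rfl, sideLine_conj_mem_rightHull⟩
  have h1 := mul_left_cancel₀ scale_ne_zero (mem_singleton_iff.1 hmem)
  have h2 := sideLine_re_pos 1 one_ne_zero (le_refl (1 : ℝ))
  rw [h1, sqrtDriver_one] at h2
  exact lt_irrefl _ h2

/-! ### Regularity of the driver -/

theorem contDiffOn_driver : ContDiffOn ℝ ∞ driver (Icc 0 2 \ {1}) := fun _ ht =>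
  (contDiffAt_const.mul (contDiffAt_sqrtDriver ht.2)).contDiffWithinAt

/-- The driver vanishes at time `1`, so differentiability there would give its square derivative
zero; but the square is a nonconstant affine function. -/
theorem not_contDiffWithinAt_driver : ¬ ContDiffWithinAt ℝ ∞ driver (Icc 0 2) 1 := by
  intro h
  have hd := ((h.differentiableWithinAt (by simp)).mono
    (Icc_subset_Icc_left zero_le_one : Icc (1 : ℝ) 2 ⊆ Icc 0 2)).hasDerivWithinAt
  have h1 := hd.pow 2
  have h2 : HasDerivWithinAt (driver ^ 2) (scale ^ 2 * (4 * 1)) (Icc 1 2) 1 := by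
    have : driver ^ 2 = fun s : ℝ => scale ^ 2 * (4 * ((s : ℂ) - 1)) := by
      funext s
      rw [Pi.pow_apply, driver, mul_pow, sqrtDriver_sq]
    rw [this]
    exact (((hasDerivAt_sub_one 1).const_mul 4).const_mul _).hasDerivWithinAt
  have h3 := (uniqueDiffOn_Icc one_lt_two 1 ⟨le_rfl, one_le_two⟩).eq_deriv _ h1 h2
  rw [driver, sqrtDriver_one] at h3
  norm_num at h3
  exact scale_ne_zero h3

end ComplexLoewner

theorem mainTheorem4 :
    ∃ (lam : ℝ → ℂ) (τ : ℝ) (γ : ℝ → ℂ),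
      ContinuousOn lam (Icc 0 2) ∧
      -- the driver is smooth exactly away from the single time `τ`
      τ ∈ Icc (0 : ℝ) 2 ∧
      ContDiffOn ℝ ∞ lam (Icc 0 2 \ {τ}) ∧
      ¬ ContDiffWithinAt ℝ ∞ lam (Icc 0 2) τ ∧
      -- the sufficient condition fails
      ¬ ComplexLoewner.HullsMeetOnlyAtDriver lam 2 ∧
      -- nevertheless the driver creates a simple two-sided curve
      ComplexLoewner.CreatesTwoSidedCurve lam 2 γ ∧
      ComplexLoewner.IsSimpleTwoSidedCurve 2 γ ∧
      -- one end rests from time `1` on; otherwise both ends keep growing up to time `2`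
      (∀ u ∈ Icc (-2 : ℝ) (-1), γ u = γ (-1)) ∧
      InjOn γ (Icc (-1) 2) :=
  ⟨ComplexLoewner.driver, 1, ComplexLoewner.curve,
    ComplexLoewner.continuous_driver.continuousOn, ⟨zero_le_one, one_le_two⟩,
    ComplexLoewner.contDiffOn_driver, ComplexLoewner.not_contDiffWithinAt_driver,
    ComplexLoewner.not_hullsMeetOnlyAtDriver, ComplexLoewner.createsTwoSidedCurve,
    ComplexLoewner.isSimpleTwoSidedCurve,
    fun _ hu => ComplexLoewner.curve_eq_of_le_neg_one hu.2, ComplexLoewner.injOn_curve⟩
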